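/- Let $\mathbb K$ be $\mathbb R$ or $\mathbb C$. A sequence $(x_n)_{n\ge 0}$ in a topological vector space $X$ over $\mathbb K$ is called an $\ell_1$-sequence if $x_n\to 0$ and the series $\sum_{n=0}^\infty a_nx_n$ converges in $X$ for every $a\in\ell_1$. The topology of $X$ is called weak if it coincides with $\sigma(X,Y)$, the coarsest topology making all functionals from $Y$ continuous, for some linear space $Y$ of linear functionals on $X$ that separates the points of $X$. Let $\mathfrak M$ be the class of Hausdorff locally convex spaces $X$ over $\mathbb K$ whose topology is not weak and which contain an $\ell_1$-sequence with dense linear span. A continuous linear operator $T:X\to X$ is hypercyclic if the orbit $\{T^nx:n\ge 0\}$ is dense in $X$ for some $x\in X$; it is mixing if for all non-empty open sets $U,V\subseteq X$ one has $T^n(U)\cap V\ne\varnothing$ for all sufficiently large $n$. **Theorem 1.7.** For every $X\in\mathfrak M$ there is a continuous linear operator $T:X\to X$ that is hypercyclic and not mixing. In particular, every separable infinite-dimensional Banach space over $\mathbb K$ carries a continuous linear operator that is hypercyclic and not mixing. -/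

import Mathlib

open Filter Topology

/-- The topology of `X` is a weak topology: it coincides with `σ(X, Y)`, the coarsest topology
making all functionals from `Y` continuous, for some linear space `Y` of linear functionals
on `X` that separates the points of `X`. -/
def CarriesWeakTopology (𝕜 X : Type*) [RCLike 𝕜] [AddCommGroup X] [Module 𝕜 X]
    [t : TopologicalSpace X] : Prop :=
  ∃ Y : Submodule 𝕜 (Module.Dual 𝕜 X),
    (∀ x : X, x ≠ 0 → ∃ f ∈ Y, f x ≠ 0) ∧
    t = ⨅ f : Y, TopologicalSpace.induced (fun x : X => (f : Module.Dual 𝕜 X) x) (inferInstance : TopologicalSpace 𝕜)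

/-- `x` is an `ℓ₁`-sequence: `x n → 0`, and the series `∑ a n • x n` converges (its partial sums
have a limit) for every `a ∈ ℓ₁`. -/
def IsEllOneSequence (𝕜 : Type*) {X : Type*} [RCLike 𝕜] [AddCommGroup X] [Module 𝕜 X]
    [TopologicalSpace X] (x : ℕ → X) : Prop :=
  Tendsto x atTop (𝓝 0) ∧
    ∀ a : ℕ → 𝕜, Summable (fun n => ‖a n‖) →
      ∃ s : X, Tendsto (fun N => ∑ n ∈ Finset.range N, a n • x n) atTop (𝓝 s)

/-- Membership of a (Hausdorff) locally convex space `X` over `𝕜` in the class `𝔐`. -/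
structure MemClassM (𝕜 X : Type*) [RCLike 𝕜] [AddCommGroup X] [Module 𝕜 X] [Module ℝ X]
    [IsScalarTower ℝ 𝕜 X] [TopologicalSpace X] [IsTopologicalAddGroup X] [ContinuousSMul 𝕜 X]
    [LocallyConvexSpace ℝ X] [T2Space X] : Prop where
  not_weak : ¬ CarriesWeakTopology 𝕜 X
  exists_seq : ∃ x : ℕ → X, IsEllOneSequence 𝕜 x ∧
    Dense (Submodule.span 𝕜 (Set.range x) : Set X)

/-- `T` is hypercyclic: some orbit `{T ^ n x : n ≥ 0}` is dense. -/
def IsHypercyclic {𝕜 X : Type*} [RCLike 𝕜] [AddCommGroup X] [Module 𝕜 X] [TopologicalSpace X]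
    (T : X →L[𝕜] X) : Prop :=
  ∃ x : X, Dense (Set.range fun n : ℕ => (T ^ n) x)

/-- `T` is (topologically) mixing: for all non-empty open `U`, `V`, the set `T ^ n (U)` meets `V`
for all large enough `n`. -/
def IsMixing {𝕜 X : Type*} [RCLike 𝕜] [AddCommGroup X] [Module 𝕜 X] [TopologicalSpace X]
    (T : X →L[𝕜] X) : Prop :=
  ∀ U V : Set X, IsOpen U → U.Nonempty → IsOpen V → V.Nonempty →
    ∃ N : ℕ, ∀ n : ℕ, N < n → ((fun x => (T ^ n) x) '' U ∩ V).Nonempty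

section Chain

open Polynomial

variable {𝕜 V : Type*} [RCLike 𝕜] [NormedAddCommGroup V] [NormedSpace 𝕜 V]

/-- The Newton interpolation map `P ↦ ∑ k < D, (Δ ^ k P)(0) • b k`. -/
noncomputable def newtonSum (D : ℕ) (b : ℕ → V) (P : 𝕜[X]) : V :=
  ∑ k ∈ Finset.range D, ((fwdDiff 1)^[k] (fun x => P.eval x)) 0 • b k

theorem newtonSum_add (D : ℕ) (b : ℕ → V) (P Q : 𝕜[X]) :
    newtonSum D b (P + Q) = newtonSum D b P + newtonSum D b Q := by
  have : (fun x => (P + Q).eval x) = (fun x => P.eval x) + fun x => Q.eval x := by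
    ext x; simp
  simp only [newtonSum, this, fwdDiff_iter_add, Pi.add_apply, add_smul, Finset.sum_add_distrib]

theorem newtonSum_smul (D : ℕ) (b : ℕ → V) (c : 𝕜) (P : 𝕜[X]) :
    newtonSum D b (c • P) = c • newtonSum D b P := by
  have : (fun x => (c • P).eval x) = c • (fun x => P.eval x) := by
    ext x; simp
  simp only [newtonSum, this, fwdDiff_iter_const_smul, Pi.smul_apply, smul_eq_mul, mul_smul,
    Finset.smul_sum]

theorem tendsto_newtonSum (D : ℕ) (b : ℕ → V) {P : ℕ → 𝕜[X]} {Q : 𝕜[X]}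
    (h : ∀ x, Tendsto (fun n => (P n).eval x) atTop (𝓝 (Q.eval x))) :
    Tendsto (fun n => newtonSum D b (P n)) atTop (𝓝 (newtonSum D b Q)) := by
  unfold newtonSum
  refine tendsto_finsetSum _ fun k _ => Tendsto.smul_const ?_ _
  simp only [fwdDiff_iter_eq_sum_shift]
  exact tendsto_finsetSum _ fun j _ => (h _).const_smul _

theorem newtonSum_shift {D : ℕ} {b : ℕ → V} {N : V →L[𝕜] V} (h0 : N (b 0) = 0)
    (hb : ∀ k, k + 1 < D → N (b (k + 1)) = b k) {P : 𝕜[X]} (hP : P.natDegree < D) :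
    (1 + N) (newtonSum D b P) = newtonSum D b (P.comp (X + 1)) := by
  have hs : (fun x => (P.comp (X + 1)).eval x)
      = (fun x => P.eval x) + fwdDiff 1 (fun x => P.eval x) := by
    ext x; simp [fwdDiff]
  have hz := Polynomial.fwdDiff_iter_eq_zero_of_degree_lt hP
  obtain ⟨D, rfl⟩ : ∃ D', D = D' + 1 := ⟨D - 1, by omega⟩
  rw [add_apply, one_apply_eq_self]
  simp only [newtonSum, hs, fwdDiff_iter_add, Pi.add_apply, add_smul, Finset.sum_add_distrib,
    map_sum, map_smul, ← Function.iterate_succ_apply]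
  congr 1
  rw [Finset.sum_range_succ', Finset.sum_range_succ]
  have : ((fwdDiff 1)^[D.succ] (fun x => P.eval x)) 0 = 0 := congrFun hz 0
  rw [this, h0]
  simp only [smul_zero, add_zero, zero_smul]
  refine Finset.sum_congr rfl fun k hk => ?_
  rw [hb k (by have := Finset.mem_range.1 hk; omega)]

theorem newtonSum_shift_pow {D : ℕ} {b : ℕ → V} {N : V →L[𝕜] V} (h0 : N (b 0) = 0)
    (hb : ∀ k, k + 1 < D → N (b (k + 1)) = b k) {P : 𝕜[X]} (hP : P.natDegree < D) (n : ℕ) :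
    ((1 + N) ^ n) (newtonSum D b P) = newtonSum D b (P.comp (X + C (n : 𝕜))) := by
  induction n with
  | zero => simp
  | succ n ih =>
    rw [pow_succ', mul_apply_eq_comp, ih, newtonSum_shift h0 hb]
    · rw [Polynomial.comp_assoc]
      congr 2
      simp
      ring
    · rw [Polynomial.natDegree_comp, natDegree_X_add_C, mul_one]
      exact hP

/-- If `N` acts on `b 0, …, b (2 d - 1)` as a Jordan block, then `1 + N` moves vectors close to
one Newton image of a polynomial of degree `< d` to vectors close to another one. -/
theorem exists_tendsto_newtonSum {d : ℕ} {b : ℕ → V} {N : V →L[𝕜] V} (h0 : N (b 0) = 0)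
    (hb : ∀ k, k + 1 < 2 * d → N (b (k + 1)) = b k) {P Q : 𝕜[X]}
    (hP : P.natDegree < d) (hQ : Q.natDegree < d) :
    ∃ x : ℕ → V, (∀ n, x n ∈ Submodule.span 𝕜 (b '' Set.Iio (2 * d))) ∧
      Tendsto x atTop (𝓝 (newtonSum (2 * d) b P)) ∧
      Tendsto (fun n => ((1 + N) ^ n : V →L[𝕜] V) (x n)) atTop (𝓝 (newtonSum (2 * d) b Q)) := by
  have hinv : Tendsto (fun n : ℕ => ((n : 𝕜))⁻¹) atTop (𝓝 0) :=
    tendsto_inv_atTop_nhds_zero_nat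
  have hgrow : ∀ (R : 𝕜[X]), R.natDegree < d → ∀ (ε x : 𝕜),
      Tendsto (fun n : ℕ => ((n : 𝕜))⁻¹ ^ d * R.eval (x + ε * n)) atTop (𝓝 0) := by
    intro R hR ε x
    simp only [Polynomial.eval_eq_sum_range, Finset.mul_sum]
    rw [← Finset.sum_const_zero (s := Finset.range (R.natDegree + 1))]
    refine tendsto_finsetSum _ fun j hj => ?_
    have hj : j < d := by have := Finset.mem_range.1 hj; omega
    have h1 : Tendsto (fun n : ℕ => R.coeff j * ((n : 𝕜)⁻¹ ^ (d - j) *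
        (x * (n : 𝕜)⁻¹ + ε) ^ j)) atTop (𝓝 (R.coeff j * (0 ^ (d - j) * (x * 0 + ε) ^ j))) :=
      ((hinv.pow _).mul (((hinv.const_mul x).add_const ε).pow j)).const_mul _
    rw [zero_pow (by omega), zero_mul, mul_zero] at h1
    refine h1.congr' ?_
    filter_upwards [eventually_gt_atTop 0] with n hn
    have hn' : (n : 𝕜) ≠ 0 := by exact_mod_cast hn.ne'
    have : x + ε * n = (x * (n : 𝕜)⁻¹ + ε) * n := by field_simp
    rw [this, mul_pow]
    have h2 : (n : 𝕜)⁻¹ ^ d = (n : 𝕜)⁻¹ ^ (d - j) * (n : 𝕜)⁻¹ ^ j := by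
      rw [← pow_add]; congr 1; omega
    have h3 : (n : 𝕜)⁻¹ ^ j * (n : 𝕜) ^ j = 1 := by
      rw [← mul_pow, inv_mul_cancel₀ hn', one_pow]
    rw [h2]
    linear_combination (-(R.coeff j * (n : 𝕜)⁻¹ ^ (d - j) * (x * (n : 𝕜)⁻¹ + ε) ^ j)) * h3
  let R : ℕ → 𝕜[X] := fun n => (1 - C ((n : 𝕜)⁻¹) * X) ^ d * P +
    (C ((n : 𝕜)⁻¹) * X) ^ d * Q.comp (X - C (n : 𝕜))
  have hlin : ∀ c : 𝕜, (C c * X : 𝕜[X]).natDegree ≤ 1 := fun c =>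
    (natDegree_C_mul_le _ _).trans natDegree_X_le
  have hdeg : ∀ n, (R n).natDegree < 2 * d := by
    intro n
    have h1 : (1 - C ((n : 𝕜)⁻¹) * X : 𝕜[X]).natDegree ≤ 1 :=
      (natDegree_sub_le _ _).trans (by simpa using hlin _)
    have h2 := natDegree_pow_le_of_le d h1
    have h3 := natDegree_pow_le_of_le d (hlin ((n : 𝕜)⁻¹))
    have h4 : (Q.comp (X - C (n : 𝕜))).natDegree = Q.natDegree := by
      rw [natDegree_comp, natDegree_X_sub_C, mul_one]
    refine (natDegree_add_le _ _).trans_lt (max_lt ?_ ?_)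
    · refine natDegree_mul_le.trans_lt ?_
      omega
    · refine natDegree_mul_le.trans_lt ?_
      omega
  refine ⟨fun n => newtonSum (2 * d) b (R n), fun n => Submodule.sum_mem _ fun k hk =>
    Submodule.smul_mem _ _ (Submodule.subset_span ⟨k, Finset.mem_range.1 hk, rfl⟩),
    tendsto_newtonSum _ _ fun x => ?_, ?_⟩
  · have h1 : Tendsto (fun n : ℕ => (1 - (n : 𝕜)⁻¹ * x) ^ d * P.eval x +
        x ^ d * ((n : 𝕜)⁻¹ ^ d * Q.eval (x + (-1) * n))) atTop
        (𝓝 ((1 - 0 * x) ^ d * P.eval x + x ^ d * 0)) :=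
      (((hinv.mul_const x).const_sub 1).pow d |>.mul_const _).add ((hgrow Q hQ (-1) x).const_mul _)
    simp only [zero_mul, sub_zero, one_pow, one_mul, mul_zero, add_zero] at h1
    refine h1.congr fun n => ?_
    simp [R, mul_pow, ← sub_eq_add_neg]
    ring
  · simp only [newtonSum_shift_pow h0 hb (hdeg _)]
    refine tendsto_newtonSum _ _ fun x => ?_
    have h1 : Tendsto (fun n : ℕ => (-x) ^ d * ((n : 𝕜)⁻¹ ^ d * P.eval (x + 1 * n)) +
        ((n : 𝕜)⁻¹ * x + 1) ^ d * Q.eval x) atTop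
        (𝓝 ((-x) ^ d * 0 + (0 * x + 1) ^ d * Q.eval x)) :=
      ((hgrow P hP 1 x).const_mul _).add ((((hinv.mul_const x).add_const 1).pow d).mul_const _)
    simp only [zero_mul, zero_add, one_pow, one_mul, mul_zero] at h1
    refine h1.congr' ?_
    filter_upwards [eventually_gt_atTop 0] with n hn
    have hn' : (n : 𝕜) ≠ 0 := by exact_mod_cast hn.ne'
    have e2 : (n : 𝕜)⁻¹ * (x + n) = (n : 𝕜)⁻¹ * x + 1 := by field_simp
    simp only [R, eval_comp, eval_add, eval_mul, eval_pow, eval_sub, eval_one, eval_C, eval_X,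
      add_sub_cancel_right, e2]
    have e3 : 1 - ((n : 𝕜)⁻¹ * x + 1) = (n : 𝕜)⁻¹ * (-x) := by ring
    rw [e3, mul_pow]
    ring

/-- A family which is unitriangular up to scalars with respect to `e` spans the same flag. -/
theorem mem_span_of_triangular {d : ℕ} {e m : ℕ → V} {γ : ℕ → 𝕜} (hγ : ∀ j < d, γ j ≠ 0)
    (h : ∀ j < d, m j - γ j • e j ∈ Submodule.span 𝕜 (e '' Set.Iio j)) :
    Submodule.span 𝕜 (e '' Set.Iio d) ≤ Submodule.span 𝕜 (m '' Set.Iio d) := by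
  induction d with
  | zero => simp
  | succ d ih =>
    have ih' := ih (fun j hj => hγ j (by omega)) (fun j hj => h j (by omega))
    have hmono : Submodule.span 𝕜 (m '' Set.Iio d) ≤ Submodule.span 𝕜 (m '' Set.Iio (d + 1)) :=
      Submodule.span_mono (Set.image_mono (Set.Iio_subset_Iio (by omega)))
    rw [Submodule.span_le]
    rintro _ ⟨j, hj, rfl⟩
    rcases Nat.lt_succ_iff_lt_or_eq.1 hj with hj | rfl
    · exact hmono (ih' (Submodule.subset_span ⟨j, hj, rfl⟩))
    · have h1 := hmono (ih' (h j (by omega)))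
      have h2 : m j ∈ Submodule.span 𝕜 (m '' Set.Iio (j + 1)) :=
        Submodule.subset_span ⟨j, by simp, rfl⟩
      have h3 := Submodule.sub_mem _ h2 h1
      rw [sub_sub_cancel] at h3
      exact (Submodule.smul_mem_iff _ (hγ j (by omega))).1 h3

/-- For a strictly upper triangular `N` with nonvanishing superdiagonal, the powers of `1 + N`
move vectors close to `u` to vectors close to `v`, for `u`, `v` in the lower half of the flag. -/
theorem exists_tendsto_of_triangular {d : ℕ} {e : ℕ → V} {N : V →L[𝕜] V} {α : ℕ → 𝕜}
    (h0 : N (e 0) = 0) (hα : ∀ t, t + 1 < 2 * d → α t ≠ 0)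
    (h : ∀ t, t + 1 < 2 * d → N (e (t + 1)) - α t • e t ∈ Submodule.span 𝕜 (e '' Set.Iio t))
    {u v : V} (hu : u ∈ Submodule.span 𝕜 (e '' Set.Iio d))
    (hv : v ∈ Submodule.span 𝕜 (e '' Set.Iio d)) :
    ∃ x : ℕ → V, (∀ n, x n ∈ Submodule.span 𝕜 (Set.range e)) ∧ Tendsto x atTop (𝓝 u) ∧
      Tendsto (fun n => ((1 + N) ^ n : V →L[𝕜] V) (x n)) atTop (𝓝 v) := by
  rcases Nat.eq_zero_or_pos d with rfl | hd
  · have hu : u = 0 := by simpa using hu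
    have hv : v = 0 := by simpa using hv
    refine ⟨fun _ => 0, fun _ => Submodule.zero_mem _, by simp [hu], ?_⟩
    simp only [map_zero, hv]
    exact tendsto_const_nhds
  have hlow : ∀ t < 2 * d, ∀ w ∈ Submodule.span 𝕜 (e '' Set.Iio (t + 1)),
      N w ∈ Submodule.span 𝕜 (e '' Set.Iio t) := by
    intro t ht w hw
    have : Submodule.span 𝕜 (e '' Set.Iio (t + 1)) ≤
        (Submodule.span 𝕜 (e '' Set.Iio t)).comap (N : V →ₗ[𝕜] V) := by
      rw [Submodule.span_le]
      rintro _ ⟨s, hs, rfl⟩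
      have hs : s < t + 1 := hs
      rcases s with _ | s
      · simp [h0]
      · have h1 := h s (by omega)
        have h2 : α s • e s ∈ Submodule.span 𝕜 (e '' Set.Iio t) :=
          Submodule.smul_mem _ _ (Submodule.subset_span ⟨s, by simp; omega, rfl⟩)
        have h3 : Submodule.span 𝕜 (e '' Set.Iio s) ≤ Submodule.span 𝕜 (e '' Set.Iio t) :=
          Submodule.span_mono (Set.image_mono (Set.Iio_subset_Iio (by omega)))
        have := Submodule.add_mem _ (h3 h1) h2
        simpa using this
    exact this hw
  -- the Jordan chain generated by the last vector
  let b : ℕ → V := fun k => (N ^ (2 * d - 1 - k)) (e (2 * d - 1))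
  have hb : ∀ k, k + 1 < 2 * d → N (b (k + 1)) = b k := by
    intro k hk
    change N ((N ^ _) _) = (N ^ _) _
    rw [← mul_apply_eq_comp, ← pow_succ']
    congr 2; omega
  have key : ∀ i k, k + i = 2 * d - 1 → ∃ β : 𝕜, β ≠ 0 ∧
      b k - β • e k ∈ Submodule.span 𝕜 (e '' Set.Iio k) := by
    intro i
    induction i with
    | zero =>
      intro k hk
      obtain rfl : k = 2 * d - 1 := by omega
      exact ⟨1, one_ne_zero, by simp [b]⟩
    | succ i ih =>
      intro k hk
      obtain ⟨β, hβ, h1⟩ := ih (k + 1) (by omega)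
      refine ⟨β * α k, mul_ne_zero hβ (hα k (by omega)), ?_⟩
      have h2 := hlow k (by omega) _ h1
      have h3 := Submodule.smul_mem _ β (h k (by omega))
      rw [map_sub, map_smul, hb k (by omega)] at h2
      have h4 := Submodule.add_mem _ h2 h3
      convert h4 using 1
      rw [smul_sub, mul_smul]
      abel
  choose! β hβ hkey using fun k (hk : k < 2 * d) => key (2 * d - 1 - k) k (by omega)
  have hb0 : N (b 0) = 0 := by
    have h1 : b 0 = β 0 • e 0 := by
      have := hkey 0 (by omega)
      simpa [sub_eq_zero] using this
    rw [h1, map_smul, h0, smul_zero]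
  have hmon : ∀ j < d, newtonSum (2 * d) b (X ^ j : 𝕜[X]) - ((j.factorial : 𝕜) * β j) • e j ∈
      Submodule.span 𝕜 (e '' Set.Iio j) := by
    intro j hj
    have h1 : newtonSum (2 * d) b (X ^ j : 𝕜[X]) =
        ∑ k ∈ Finset.range (j + 1), ((fwdDiff 1)^[k] (fun x : 𝕜 => x ^ j)) 0 • b k := by
      simp only [newtonSum, eval_pow, eval_X]
      symm
      refine Finset.sum_subset (Finset.range_mono (by omega)) fun k _ hk => ?_
      rw [fwdDiff_iter_pow_eq_zero_of_lt (by simpa using hk), Pi.zero_apply, zero_smul]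
    rw [h1, Finset.sum_range_succ, fwdDiff_iter_eq_factorial, add_sub_assoc]
    refine Submodule.add_mem _ (Submodule.sum_mem _ fun k hk => Submodule.smul_mem _ _ ?_) ?_
    · have hk := Finset.mem_range.1 hk
      have h2 := hkey k (by omega)
      have h3 : Submodule.span 𝕜 (e '' Set.Iio k) ≤ Submodule.span 𝕜 (e '' Set.Iio j) :=
        Submodule.span_mono (Set.image_mono (Set.Iio_subset_Iio (by omega)))
      have h4 : β k • e k ∈ Submodule.span 𝕜 (e '' Set.Iio j) :=
        Submodule.smul_mem _ _ (Submodule.subset_span ⟨k, hk, rfl⟩)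
      simpa using Submodule.add_mem _ (h3 h2) h4
    · have := Submodule.smul_mem _ (j.factorial : 𝕜) (hkey j (by omega))
      simpa [smul_sub, mul_smul] using this
  have hspan := mem_span_of_triangular (d := d) (e := e)
    (m := fun j => newtonSum (2 * d) b (X ^ j : 𝕜[X])) (γ := fun j => (j.factorial : 𝕜) * β j)
    (fun j hj => mul_ne_zero (by exact_mod_cast j.factorial_ne_zero) (hβ j (by omega))) hmon
  have hex : ∀ w ∈ Submodule.span 𝕜 (e '' Set.Iio d), ∃ P : 𝕜[X], P.natDegree < d ∧
      newtonSum (2 * d) b P = w := by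
    intro w hw
    refine Submodule.span_induction ?_ ?_ ?_ ?_ (hspan hw)
    · rintro _ ⟨j, hj, rfl⟩
      exact ⟨X ^ j, by simpa using hj, rfl⟩
    · exact ⟨0, by simpa using hd, by simp [newtonSum, fwdDiff_iter_eq_sum_shift]⟩
    · rintro _ _ _ _ ⟨P, hP, rfl⟩ ⟨Q, hQ, rfl⟩
      exact ⟨P + Q, (natDegree_add_le _ _).trans_lt (max_lt hP hQ), newtonSum_add _ _ _ _⟩
    · rintro c _ _ ⟨P, hP, rfl⟩
      exact ⟨c • P, (natDegree_smul_le _ _).trans_lt hP, newtonSum_smul _ _ _ _⟩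
  obtain ⟨P, hP, rfl⟩ := hex u hu
  obtain ⟨Q, hQ, rfl⟩ := hex v hv
  obtain ⟨x, hx, hx'⟩ := exists_tendsto_newtonSum hb0 hb hP hQ
  refine ⟨x, fun n => Submodule.span_le.2 ?_ (hx n), hx'⟩
  rintro _ ⟨k, hk, rfl⟩
  have h1 := Submodule.span_mono (Set.image_subset_range _ _) (hkey k hk)
  have h2 := Submodule.smul_mem _ (β k)
    (Submodule.subset_span (R := 𝕜) (Set.mem_range_self (f := e) k))
  simpa using Submodule.add_mem _ h1 h2

end Chain

section Biorthogonal

/-- Recursive choice of a sequence whose `n`-th term depends on all the previous ones. -/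
theorem exists_seq_of_forall_prefix {α : Type*} [Nonempty α] (Q : ℕ → (ℕ → α) → α → Prop)
    (hlocal : ∀ n f f', (∀ m < n, f m = f' m) → ∀ y, Q n f y → Q n f' y)
    (h : ∀ n f, (∀ m < n, Q m f (f m)) → ∃ y, Q n f y) :
    ∃ f : ℕ → α, ∀ n, Q n f (f n) := by
  choose! F hF using h
  let G : (n : ℕ) → (∀ m < n, α) → α := fun n ih =>
    F n (fun m => if hm : m < n then ih m hm else Classical.arbitrary α)
  let f : ℕ → α := fun n => Nat.strongRec (motive := fun _ => α) G n
  have hf : ∀ n, f n = F n (fun m => if m < n then f m else Classical.arbitrary α) := by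
    intro n
    change Nat.strongRec (motive := fun _ => α) G n = _
    rw [Nat.strongRec]
    simp only [G, f, dite_eq_ite]
  refine ⟨f, fun n => ?_⟩
  induction n using Nat.strong_induction_on with
  | _ n ih =>
    rw [hf n]
    refine hlocal n _ f (fun m hm => if_pos hm) _ (hF n _ fun m hm => ?_)
    simp only [if_pos hm]
    exact hlocal m f _ (fun k hk => (if_pos (hk.trans hm)).symm) _ (ih m hm)

variable {𝕜 Y Z : Type*} [RCLike 𝕜] [NormedAddCommGroup Y] [NormedSpace 𝕜 Y]
  [NormedAddCommGroup Z] [NormedSpace 𝕜 Z]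

/-- A finite biorthogonal system can be extended by one pair so that a given vector becomes
almost a member of the span. -/
theorem exists_extend_biorthogonal (i : Y →L[𝕜] Z)
    (hi : ¬ FiniteDimensional 𝕜 (LinearMap.range (i : Y →ₗ[𝕜] Z))) (n : ℕ)
    (e : ℕ → Y) (g : ℕ → Z →L[𝕜] 𝕜)
    (heg : ∀ s < n, ∀ t < n, g s (i (e t)) = if s = t then 1 else 0)
    (y : Y) {ε : ℝ} (hε : 0 < ε) :
    ∃ (e' : Y) (g' : Z →L[𝕜] 𝕜), (∀ s < n, g s (i e') = 0) ∧ (∀ s < n, g' (i (e s)) = 0) ∧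
      g' (i e') = 1 ∧ ∃ w ∈ Submodule.span 𝕜 (e '' Set.Iio n), ‖y - (w + e')‖ < ε := by
  have hker : ∀ y : Y, ∀ s < n, g s (i (y - ∑ t ∈ Finset.range n, g t (i y) • e t)) = 0 := by
    intro y s hs
    simp only [map_sub, map_sum, map_smul, smul_eq_mul]
    rw [Finset.sum_congr rfl fun t ht => by rw [heg s hs t (Finset.mem_range.1 ht)]]
    simp [hs]
  obtain ⟨z, hz, hiz⟩ : ∃ z : Y, (∀ s < n, g s (i z) = 0) ∧ i z ≠ 0 := by
    by_contra! hcon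
    refine hi ?_
    have hle : LinearMap.range (i : Y →ₗ[𝕜] Z) ≤
        Submodule.span 𝕜 ((fun t => i (e t)) '' (Finset.range n : Set ℕ)) := by
      rintro _ ⟨y, rfl⟩
      have h1 := hcon _ (hker y)
      rw [map_sub, sub_eq_zero] at h1
      change i y ∈ _
      rw [h1, map_sum]
      refine Submodule.sum_mem _ fun t ht => ?_
      rw [map_smul]
      exact Submodule.smul_mem _ _ (Submodule.subset_span ⟨t, ht, rfl⟩)
    have : FiniteDimensional 𝕜
        (Submodule.span 𝕜 ((fun t => i (e t)) '' (Finset.range n : Set ℕ))) :=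
      FiniteDimensional.span_of_finite 𝕜 ((Finset.finite_toSet _).image _)
    exact Submodule.finiteDimensional_of_le hle
  set p : Y := ∑ t ∈ Finset.range n, g t (i y) • e t with hp
  have hpmem : p ∈ Submodule.span 𝕜 (e '' Set.Iio n) :=
    Submodule.sum_mem _ fun t ht => Submodule.smul_mem _ _
      (Submodule.subset_span ⟨t, Finset.mem_range.1 ht, rfl⟩)
  obtain ⟨u, hu, hiu, hclose⟩ : ∃ u : Y, (∀ s < n, g s (i u) = 0) ∧ i u ≠ 0 ∧
      ‖y - (p + u)‖ < ε := by
    by_cases h0 : i (y - p) = 0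
    · obtain ⟨c, hc0, hc⟩ : ∃ c : 𝕜, c ≠ 0 ∧ ‖c • z‖ < ε := by
        have h1 : Tendsto (fun c : 𝕜 => ‖c • z‖) (𝓝[≠] 0) (𝓝 ‖(0 : 𝕜) • z‖) :=
          ((continuous_id.smul continuous_const).norm.tendsto 0).mono_left nhdsWithin_le_nhds
        rw [zero_smul, norm_zero] at h1
        exact ((eventually_mem_nhdsWithin).and (h1.eventually_lt_const hε)).exists
      refine ⟨y - p + c • z, fun s hs => ?_, ?_, ?_⟩
      · rw [map_add, map_add, hker y s hs, map_smul, map_smul, hz s hs]; simp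
      · rw [map_add, h0, zero_add, map_smul]; exact smul_ne_zero hc0 hiz
      · have : y - (p + (y - p + c • z)) = -(c • z) := by abel
        rwa [this, norm_neg]
    · exact ⟨y - p, hker y, h0, by simpa using hε⟩
  obtain ⟨h, hh⟩ := SeparatingDual.exists_ne_zero (R := 𝕜) hiu
  refine ⟨u, (h (i u))⁻¹ • (h - ∑ t ∈ Finset.range n, h (i (e t)) • g t), hu, fun s hs => ?_, ?_,
    p, hpmem, hclose⟩
  · simp only [smul_apply, sub_apply, sum_apply, smul_eq_mul]
    rw [Finset.sum_congr rfl fun t ht => by rw [heg t (Finset.mem_range.1 ht) s hs]]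
    simp [hs]
  · simp only [smul_apply, sub_apply, sum_apply, smul_eq_mul]
    rw [Finset.sum_congr rfl fun t ht => by rw [hu t (Finset.mem_range.1 ht)]]
    simp [hh]

/-- An operator with infinite-dimensional range on a separable space admits a biorthogonal system
whose vectors have dense span. -/
theorem exists_biorthogonal_nat [TopologicalSpace.SeparableSpace Y] (i : Y →L[𝕜] Z)
    (hi : ¬ FiniteDimensional 𝕜 (LinearMap.range (i : Y →ₗ[𝕜] Z))) :
    ∃ (e : ℕ → Y) (g : ℕ → Z →L[𝕜] 𝕜), (∀ s t, g s (i (e t)) = if s = t then 1 else 0) ∧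
      Dense (Submodule.span 𝕜 (Set.range e) : Set Y) := by
  let Q : ℕ → (ℕ → Y × (Z →L[𝕜] 𝕜)) → Y × (Z →L[𝕜] 𝕜) → Prop := fun n f a =>
    (∀ s < n, (f s).2 (i a.1) = 0) ∧ (∀ s < n, a.2 (i (f s).1) = 0) ∧ a.2 (i a.1) = 1 ∧
      ∃ w ∈ Submodule.span 𝕜 ((fun k => (f k).1) '' Set.Iio n),
        ‖TopologicalSpace.denseSeq Y n.unpair.1 - (w + a.1)‖ < 1 / ((n : ℝ) + 1)
  obtain ⟨f, hf⟩ := exists_seq_of_forall_prefix Q (by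
      rintro n f f' hff' a ⟨h1, h2, h3, w, hw, h4⟩
      refine ⟨fun s hs => hff' s hs ▸ h1 s hs, fun s hs => hff' s hs ▸ h2 s hs, h3, w, ?_, h4⟩
      convert hw using 2
      exact Set.image_congr fun k hk => by rw [hff' k hk]) (by
      intro n f hf
      have heg : ∀ s < n, ∀ t < n, (f s).2 (i (f t).1) = if s = t then 1 else 0 := by
        intro s hs t ht
        rcases lt_trichotomy s t with h | rfl | h
        · rw [if_neg h.ne, (hf t ht).1 s h]
        · rw [if_pos rfl, (hf s hs).2.2.1]
        · rw [if_neg h.ne', (hf s hs).2.1 t h]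
      obtain ⟨e', g', h1, h2, h3, h4⟩ := exists_extend_biorthogonal i hi n (fun k => (f k).1)
        (fun k => (f k).2) heg (TopologicalSpace.denseSeq Y n.unpair.1)
        (ε := 1 / ((n : ℝ) + 1)) (by positivity)
      exact ⟨(e', g'), h1, h2, h3, h4⟩)
  refine ⟨fun k => (f k).1, fun k => (f k).2, fun s t => ?_, ?_⟩
  · rcases lt_trichotomy s t with h | rfl | h
    · rw [if_neg h.ne, (hf t).1 s h]
    · rw [if_pos rfl, (hf s).2.2.1]
    · rw [if_neg h.ne', (hf s).2.1 t h]
  · have hsub : Set.range (TopologicalSpace.denseSeq Y) ⊆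
        closure (Submodule.span 𝕜 (Set.range fun k => (f k).1) : Set Y) := by
      rintro _ ⟨k, rfl⟩
      rw [Metric.mem_closure_iff]
      intro ε hε
      obtain ⟨M, hM⟩ := exists_nat_one_div_lt hε
      obtain ⟨-, -, -, w, hw, hlt⟩ := hf (Nat.pair k M)
      rw [Nat.unpair_pair] at hlt
      refine ⟨w + (f (Nat.pair k M)).1, Submodule.add_mem _
        (Submodule.span_mono (Set.image_subset_range _ _) hw) (Submodule.subset_span ⟨_, rfl⟩), ?_⟩
      rw [dist_eq_norm]
      refine hlt.trans (lt_of_le_of_lt ?_ hM)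
      have : (M : ℝ) ≤ (Nat.pair k M : ℕ) := by exact_mod_cast Nat.right_le_pair k M
      exact one_div_le_one_div_of_le (by positivity) (by linarith)
    rw [dense_iff_closure_eq]
    refine Set.eq_univ_of_univ_subset ?_
    rw [← (TopologicalSpace.denseRange_denseSeq Y).closure_range]
    exact closure_minimal hsub isClosed_closure

theorem exists_biorthogonal_int [TopologicalSpace.SeparableSpace Y] (i : Y →L[𝕜] Z)
    (hi : ¬ FiniteDimensional 𝕜 (LinearMap.range (i : Y →ₗ[𝕜] Z))) :
    ∃ (e : ℤ → Y) (g : ℤ → Z →L[𝕜] 𝕜), (∀ s t, g s (i (e t)) = if s = t then 1 else 0) ∧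
      Dense (Submodule.span 𝕜 (Set.range e) : Set Y) := by
  obtain ⟨e, g, heg, hd⟩ := exists_biorthogonal_nat i hi
  refine ⟨e ∘ Equiv.intEquivNat, g ∘ Equiv.intEquivNat, fun s t => ?_, ?_⟩
  · simp [heg]
  · rwa [Equiv.intEquivNat.surjective.range_comp]

end Biorthogonal

section Triangular

variable {𝕜 : Type*} [RCLike 𝕜]

theorem exists_sub_smul_mem_span {V : Type*} [AddCommGroup V] [Module 𝕜 V] {e : ℕ → V} {t : ℕ}
    {x : V} (hx : x ∈ Submodule.span 𝕜 (e '' Set.Iio (t + 1))) :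
    ∃ c : 𝕜, x - c • e t ∈ Submodule.span 𝕜 (e '' Set.Iio t) := by
  have : Set.Iio (t + 1) = insert t (Set.Iio t) := by
    ext k; simp only [Set.mem_Iio, Set.mem_insert_iff]; omega
  rw [this, Set.image_insert_eq, Submodule.mem_span_insert] at hx
  obtain ⟨c, z, hz, rfl⟩ := hx
  exact ⟨c, by simpa using hz⟩

/-- All small nonzero multiples of a shift turn a strictly upper triangular operator into one whose
unipotent powers connect any two vectors of the lower half of the flag. -/
theorem eventually_exists_tendsto {V : Type*} [NormedAddCommGroup V] [NormedSpace 𝕜 V]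
    {e : ℕ → V} {N S : V →L[𝕜] V} {d : ℕ}
    (hN : ∀ t, N (e t) ∈ Submodule.span 𝕜 (e '' Set.Iio t)) (hS0 : S (e 0) = 0)
    (hS : ∀ t, t + 1 < 2 * d → S (e (t + 1)) = e t)
    {u v : V} (hu : u ∈ Submodule.span 𝕜 (e '' Set.Iio d))
    (hv : v ∈ Submodule.span 𝕜 (e '' Set.Iio d)) :
    ∀ᶠ δ : 𝕜 in 𝓝[≠] 0, ∃ x : ℕ → V,
      (∀ n, x n ∈ Submodule.span 𝕜 (Set.range e)) ∧ Tendsto x atTop (𝓝 u) ∧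
      Tendsto (fun n => ((1 + (N + δ • S)) ^ n : V →L[𝕜] V) (x n)) atTop (𝓝 v) := by
  choose c hc using fun t => exists_sub_smul_mem_span (hN (t + 1))
  have hne : ∀ᶠ δ : 𝕜 in 𝓝[≠] 0, ∀ t ∈ Finset.range (2 * d), c t + δ ≠ 0 := by
    rw [Finset.eventually_all]
    intro t _
    by_cases h0 : c t = 0
    · filter_upwards [self_mem_nhdsWithin] with δ hδ
      simpa [h0] using hδ
    · have : Tendsto (fun δ : 𝕜 => c t + δ) (𝓝[≠] 0) (𝓝 (c t + 0)) :=
        ((continuous_const.add continuous_id).tendsto 0).mono_left nhdsWithin_le_nhds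
      rw [add_zero] at this
      exact this.eventually_ne h0
  filter_upwards [hne] with δ hδ
  refine exists_tendsto_of_triangular (α := fun t => c t + δ) ?_ (fun t ht => hδ t (by simp; omega))
    (fun t ht => ?_) hu hv
  · have : N (e 0) = 0 := by simpa using hN 0
    simp [this, hS0]
  · have h1 := hc t
    have : (N + δ • S) (e (t + 1)) - (c t + δ) • e t = N (e (t + 1)) - c t • e t := by
      rw [add_apply, smul_apply, hS t ht, add_smul]
      abel
    rwa [this]

variable {Y Z : Type*} [NormedAddCommGroup Y] [NormedSpace 𝕜 Y]
  [NormedAddCommGroup Z] [NormedSpace 𝕜 Z]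

/-- The finite rank operators that are strictly upper triangular with respect to the system
`(e, g)`. -/
noncomputable def strictUpper (e : ℤ → Y) (g : ℤ → Z →L[𝕜] 𝕜) : Submodule 𝕜 (Z →L[𝕜] Y) :=
  Submodule.span 𝕜 ((fun p : ℤ × ℤ => (g p.2).smulRight (e p.1)) '' {p | p.1 < p.2})

/-- The shift `e t ↦ e (t - 1)` restricted to a window. -/
noncomputable def windowShift (e : ℤ → Y) (g : ℤ → Z →L[𝕜] 𝕜) (lo hi : ℤ) : Z →L[𝕜] Y :=
  ∑ t ∈ Finset.Ioc lo hi, (g t).smulRight (e (t - 1))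

theorem windowShift_mem (e : ℤ → Y) (g : ℤ → Z →L[𝕜] 𝕜) (lo hi : ℤ) :
    windowShift e g lo hi ∈ strictUpper e g :=
  Submodule.sum_mem _ fun t _ => Submodule.subset_span ⟨(t - 1, t), by simp, rfl⟩

variable {i : Y →L[𝕜] Z} {e : ℤ → Y} {g : ℤ → Z →L[𝕜] 𝕜}

theorem windowShift_apply (heg : ∀ s t, g s (i (e t)) = if s = t then 1 else 0) (lo hi t : ℤ) :
    windowShift e g lo hi (i (e t)) = if t ∈ Finset.Ioc lo hi then e (t - 1) else 0 := by
  simp only [windowShift, sum_apply, ContinuousLinearMap.smulRight_apply, heg, ite_smul, one_smul,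
    zero_smul]
  exact Finset.sum_ite_eq' _ t _

theorem comp_windowShift (heg : ∀ s t, g s (i (e t)) = if s = t then 1 else 0) (lo hi t : ℤ) :
    (g t).comp (i.comp (windowShift e g lo hi)) =
      if t + 1 ∈ Finset.Ioc lo hi then g (t + 1) else 0 := by
  ext z
  have : ∀ s, (g s z) * (g t (i (e (s - 1)))) = if s = t + 1 then g (t + 1) z else 0 := by
    intro s
    rw [heg]
    by_cases h : s = t + 1
    · subst h; simp
    · rw [if_neg (by omega), if_neg h, mul_zero]
  simp only [windowShift, ContinuousLinearMap.comp_apply, sum_apply,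
    ContinuousLinearMap.smulRight_apply, map_sum, map_smul, smul_eq_mul, this]
  rw [Finset.sum_ite_eq']
  split_ifs <;> simp

theorem eventually_apply_mem_span (heg : ∀ s t, g s (i (e t)) = if s = t then 1 else 0)
    {A : Z →L[𝕜] Y} (hA : A ∈ strictUpper e g) :
    ∀ᶠ K : ℤ in atTop, ∀ t, A (i (e t)) ∈ Submodule.span 𝕜 (e '' Set.Ico (-K) t) := by
  refine Submodule.span_induction ?_ ?_ ?_ ?_ hA
  · rintro _ ⟨⟨s, t⟩, hst, rfl⟩
    filter_upwards [eventually_ge_atTop (-s)] with K hK r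
    simp only [ContinuousLinearMap.smulRight_apply, heg]
    split_ifs with h
    · rw [one_smul]
      exact Submodule.subset_span ⟨s, ⟨by omega, h ▸ hst⟩, rfl⟩
    · simp
  · simp
  · intro A B _ _ hA hB
    filter_upwards [hA, hB] with K h1 h2 t
    exact Submodule.add_mem _ (h1 t) (h2 t)
  · intro c A _ hA
    filter_upwards [hA] with K h1 t
    exact Submodule.smul_mem _ _ (h1 t)

theorem eventually_comp_mem_span (heg : ∀ s t, g s (i (e t)) = if s = t then 1 else 0)
    {A : Z →L[𝕜] Y} (hA : A ∈ strictUpper e g) :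
    ∀ᶠ K : ℤ in atTop, ∀ t, (g t).comp (i.comp A) ∈ Submodule.span 𝕜 (g '' Set.Ioc t K) := by
  refine Submodule.span_induction ?_ ?_ ?_ ?_ hA
  · rintro _ ⟨⟨s, t⟩, hst, rfl⟩
    filter_upwards [eventually_ge_atTop t] with K hK r
    have : (g r).comp (i.comp ((g t).smulRight (e s))) = (g r (i (e s))) • g t := by
      ext z; simp [mul_comm]
    change (g r).comp (i.comp ((g t).smulRight (e s))) ∈ _
    rw [this, heg]
    split_ifs with h
    · rw [one_smul]
      exact Submodule.subset_span ⟨t, ⟨h ▸ hst, hK⟩, rfl⟩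
    · convert Submodule.zero_mem _
      exact zero_smul 𝕜 (g t)
  · simp
  · intro A B _ _ hA hB
    filter_upwards [hA, hB] with K h1 h2 t
    rw [ContinuousLinearMap.comp_add, ContinuousLinearMap.comp_add]
    exact Submodule.add_mem _ (h1 t) (h2 t)
  · intro c A _ hA
    filter_upwards [hA] with K h1 t
    rw [ContinuousLinearMap.comp_smul, ContinuousLinearMap.comp_smul]
    exact Submodule.smul_mem _ _ (h1 t)

theorem eventually_mem_span_Icc {V : Type*} [AddCommGroup V] [Module 𝕜 V] {e : ℤ → V} {u : V}
    (hu : u ∈ Submodule.span 𝕜 (Set.range e)) :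
    ∀ᶠ K : ℤ in atTop, u ∈ Submodule.span 𝕜 (e '' Set.Icc (-K) K) := by
  refine Submodule.span_induction ?_ ?_ ?_ ?_ hu
  · rintro _ ⟨s, rfl⟩
    filter_upwards [eventually_ge_atTop |s|] with K hK
    exact Submodule.subset_span ⟨s, abs_le.1 hK, rfl⟩
  · simp
  · intro x y _ _ hx hy
    filter_upwards [hx, hy] with K h1 h2
    exact Submodule.add_mem _ h1 h2
  · intro c x _ hx
    filter_upwards [hx] with K h1
    exact Submodule.smul_mem _ _ h1

/-- Every strictly upper triangular `A` can be perturbed so that the powers of `1 + A ∘ i` connect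
two prescribed vectors. -/
theorem exists_perturb_tendsto (heg : ∀ s t, g s (i (e t)) = if s = t then 1 else 0)
    {A : Z →L[𝕜] Y} (hA : A ∈ strictUpper e g) {u v : Y}
    (hu : u ∈ Submodule.span 𝕜 (Set.range e)) (hv : v ∈ Submodule.span 𝕜 (Set.range e)) :
    ∃ B ∈ strictUpper e g, ∀ᶠ δ : 𝕜 in 𝓝[≠] 0, ∃ x : ℕ → Y,
      (∀ n, x n ∈ Submodule.span 𝕜 (Set.range e)) ∧ Tendsto x atTop (𝓝 u) ∧
      Tendsto (fun n => ((1 + (A + δ • B).comp i) ^ n : Y →L[𝕜] Y) (x n)) atTop (𝓝 v) := by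
  obtain ⟨K, hAK, huK, hvK, hK⟩ := ((eventually_apply_mem_span heg hA).and
    ((eventually_mem_span_Icc hu).and ((eventually_mem_span_Icc hv).and
      (eventually_ge_atTop 0)))).exists
  obtain ⟨d, hd⟩ : ∃ d : ℕ, (d : ℤ) = 2 * K + 1 := ⟨(2 * K + 1).toNat, by omega⟩
  have hsub : Submodule.span 𝕜 (e '' Set.Icc (-K) K) ≤
      Submodule.span 𝕜 ((fun k : ℕ => e (-K + k)) '' Set.Iio d) := by
    refine Submodule.span_mono ?_
    rintro _ ⟨s, ⟨hs1, hs2⟩, rfl⟩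
    exact ⟨(s + K).toNat, by simp only [Set.mem_Iio]; omega, congrArg e (by omega)⟩
  refine ⟨windowShift e g (-K) (-K + 2 * d), windowShift_mem _ _ _ _, ?_⟩
  refine (eventually_exists_tendsto (e := fun k : ℕ => e (-K + k)) (N := A.comp i)
    (S := (windowShift e g (-K) (-K + 2 * d)).comp i) (d := d) (fun t => ?_) ?_ (fun t ht => ?_)
    (hsub huK) (hsub hvK)).mono fun δ ⟨x, hx, hx'⟩ => ⟨x, fun n => Submodule.span_mono
      (Set.range_subset_iff.2 fun k => Set.mem_range_self _) (hx n), hx'⟩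
  · refine Submodule.span_mono ?_ (hAK (-K + t))
    rintro _ ⟨s, ⟨hs1, hs2⟩, rfl⟩
    exact ⟨(s + K).toNat, by simp only [Set.mem_Iio]; omega, congrArg e (by omega)⟩
  · rw [ContinuousLinearMap.comp_apply, windowShift_apply heg, if_neg (by simp)]
  · rw [ContinuousLinearMap.comp_apply, windowShift_apply heg,
      if_pos (by rw [Finset.mem_Ioc]; push_cast; omega)]
    congr 1; push_cast; ring

/-- The operator `f ↦ f ∘ i ∘ A` on the dual space. -/
noncomputable def dualOperator (i : Y →L[𝕜] Z) (A : Z →L[𝕜] Y) :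
    (Z →L[𝕜] 𝕜) →L[𝕜] (Z →L[𝕜] 𝕜) :=
  (ContinuousLinearMap.compL 𝕜 Z Z 𝕜).flip (i.comp A)

theorem dualOperator_apply (A : Z →L[𝕜] Y) (f : Z →L[𝕜] 𝕜) :
    dualOperator i A f = f.comp (i.comp A) := rfl

theorem one_add_dualOperator_pow_apply (A : Z →L[𝕜] Y) (f : Z →L[𝕜] 𝕜) (n : ℕ) :
    ((1 + dualOperator i A) ^ n) f = f.comp ((1 + i.comp A) ^ n) := by
  induction n with
  | zero => ext; simp
  | succ n ih =>
    rw [pow_succ', mul_apply_eq_comp, ih, pow_succ']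
    rw [add_apply, one_apply_eq_self, dualOperator_apply]
    have hc : Commute (1 + i.comp A) (i.comp A) := (Commute.one_left _).add_left (Commute.refl _)
    rw [add_mul, one_mul, ContinuousLinearMap.comp_add, ContinuousLinearMap.comp_assoc]
    congr 2
    exact hc.pow_left n

/-- Every strictly upper triangular `A` can be perturbed so that the powers of the transpose of
`1 + i ∘ A` connect two prescribed functionals. -/
theorem exists_perturb_tendsto_dual (heg : ∀ s t, g s (i (e t)) = if s = t then 1 else 0)
    {A : Z →L[𝕜] Y} (hA : A ∈ strictUpper e g) {u v : Z →L[𝕜] 𝕜}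
    (hu : u ∈ Submodule.span 𝕜 (Set.range g)) (hv : v ∈ Submodule.span 𝕜 (Set.range g)) :
    ∃ B ∈ strictUpper e g, ∀ᶠ δ : 𝕜 in 𝓝[≠] 0, ∃ f : ℕ → Z →L[𝕜] 𝕜,
      (∀ n, f n ∈ Submodule.span 𝕜 (Set.range g)) ∧ Tendsto f atTop (𝓝 u) ∧
      Tendsto (fun n => (f n).comp ((1 + i.comp (A + δ • B)) ^ n : Z →L[𝕜] Z)) atTop (𝓝 v) := by
  obtain ⟨K, hAK, huK, hvK, hK⟩ := ((eventually_comp_mem_span heg hA).and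
    ((eventually_mem_span_Icc hu).and ((eventually_mem_span_Icc hv).and
      (eventually_ge_atTop 0)))).exists
  obtain ⟨d, hd⟩ : ∃ d : ℕ, (d : ℤ) = 2 * K + 1 := ⟨(2 * K + 1).toNat, by omega⟩
  have hsub : Submodule.span 𝕜 (g '' Set.Icc (-K) K) ≤
      Submodule.span 𝕜 ((fun k : ℕ => g (K - k)) '' Set.Iio d) := by
    refine Submodule.span_mono ?_
    rintro _ ⟨s, ⟨hs1, hs2⟩, rfl⟩
    exact ⟨(K - s).toNat, by simp only [Set.mem_Iio]; omega, congrArg g (by omega)⟩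
  refine ⟨windowShift e g (K - 2 * d) K, windowShift_mem _ _ _ _, ?_⟩
  have hlin : ∀ δ : 𝕜, dualOperator i (A + δ • windowShift e g (K - 2 * d) K) =
      dualOperator i A + δ • dualOperator i (windowShift e g (K - 2 * d) K) := by
    intro δ
    ext f z
    simp [dualOperator_apply]
  simp only [← one_add_dualOperator_pow_apply, hlin]
  refine (eventually_exists_tendsto (e := fun k : ℕ => g (K - k)) (N := dualOperator i A)
    (S := dualOperator i (windowShift e g (K - 2 * d) K)) (d := d) (fun t => ?_) ?_ (fun t ht => ?_)
    (hsub huK) (hsub hvK)).mono fun δ ⟨x, hx, hx'⟩ => ⟨x, fun n => Submodule.span_mono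
      (Set.range_subset_iff.2 fun k => Set.mem_range_self _) (hx n), hx'⟩
  · refine Submodule.span_mono ?_ (hAK (K - t))
    rintro _ ⟨s, ⟨hs1, hs2⟩, rfl⟩
    exact ⟨(K - s).toNat, by simp only [Set.mem_Iio]; omega, congrArg g (by omega)⟩
  · rw [dualOperator_apply, comp_windowShift heg, if_neg (by simp)]
  · rw [dualOperator_apply, comp_windowShift heg,
      if_pos (by rw [Finset.mem_Ioc]; push_cast; omega)]
    congr 1; push_cast; ring

end Triangular

section Generic

variable {𝕜 Y Z : Type*} [RCLike 𝕜] [NormedAddCommGroup Y] [NormedSpace 𝕜 Y]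
  [NormedAddCommGroup Z] [NormedSpace 𝕜 Z]

theorem dense_of_approx {E F G : Type*} [NormedAddCommGroup E] [NormedSpace 𝕜 E]
    [NormedAddCommGroup F] [NormedSpace 𝕜 F] [NormedAddCommGroup G] [NormedSpace 𝕜 G]
    {D : Submodule 𝕜 E} {D' : Submodule 𝕜 F} {D'' : Submodule 𝕜 G} (hD'' : Dense (D'' : Set G))
    {O : Set (D.topologicalClosure × D'.topologicalClosure × G)}
    (h : ∀ a ∈ D, ∀ f ∈ D', ∀ y ∈ D'', ∀ ε > 0, ∃ p ∈ O,
      ‖(p.1 : E) - a‖ < ε ∧ ‖(p.2.1 : F) - f‖ < ε ∧ ‖p.2.2 - y‖ < ε) : Dense O := by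
  rw [Metric.dense_iff]
  rintro ⟨⟨a, ha⟩, ⟨f, hf⟩, y⟩ ε hε
  obtain ⟨a', ha', h1⟩ := Metric.mem_closure_iff.1 ha (ε / 2) (by positivity)
  obtain ⟨f', hf', h2⟩ := Metric.mem_closure_iff.1 hf (ε / 2) (by positivity)
  obtain ⟨y', hy', h3⟩ := Metric.mem_closure_iff.1 (hD'' y) (ε / 2) (by positivity)
  obtain ⟨⟨⟨a₀, ha₀⟩, ⟨f₀, hf₀⟩, y₀⟩, hO, g1, g2, g3⟩ := h a' ha' f' hf' y' hy' (ε / 2)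
    (by positivity)
  refine ⟨_, ?_, hO⟩
  rw [← dist_eq_norm] at g1 g2 g3
  rw [Metric.mem_ball, Prod.dist_eq, Prod.dist_eq, Subtype.dist_eq, Subtype.dist_eq]
  rw [dist_comm] at h1 h2 h3
  refine max_lt ?_ (max_lt ?_ ?_)
  · exact (dist_triangle _ _ _).trans_lt (by simpa using add_lt_add g1 h1)
  · exact (dist_triangle _ _ _).trans_lt (by simpa using add_lt_add g2 h2)
  · exact (dist_triangle _ _ _).trans_lt (by simpa using add_lt_add g3 h3)

theorem baireSpace_prod {E F G : Type*} [PseudoMetricSpace E] [CompleteSpace E]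
    [PseudoMetricSpace F] [CompleteSpace F] [PseudoMetricSpace G] [CompleteSpace G] :
    BaireSpace (E × F × G) :=
  inferInstance

theorem exists_small_ne_zero {E : Type*} [NormedAddCommGroup E] [NormedSpace 𝕜 E] (B : E) {ε : ℝ}
    (hε : 0 < ε) {p : 𝕜 → Prop} (hp : ∀ᶠ δ in 𝓝[≠] 0, p δ) : ∃ δ, p δ ∧ ‖δ • B‖ < ε := by
  have h1 : Tendsto (fun c : 𝕜 => ‖c • B‖) (𝓝[≠] 0) (𝓝 ‖(0 : 𝕜) • B‖) :=
    ((continuous_id.smul continuous_const).norm.tendsto 0).mono_left nhdsWithin_le_nhds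
  rw [zero_smul, norm_zero] at h1
  exact (hp.and (h1.eventually_lt_const hε)).exists

/-- Let `i : Y → Z` have infinite-dimensional range. For some `A : Z → Y` the operator
`1 + A ∘ i` is hypercyclic, while the transpose of `1 + i ∘ A` has an orbit with a subsequence
bounded by one. -/
theorem exists_hypercyclic_one_add_comp [CompleteSpace Y] [TopologicalSpace.SeparableSpace Y]
    (i : Y →L[𝕜] Z) (hi : ¬ FiniteDimensional 𝕜 (LinearMap.range (i : Y →ₗ[𝕜] Z))) :
    ∃ (A : Z →L[𝕜] Y) (f : Z →L[𝕜] 𝕜) (y : Y), f ≠ 0 ∧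
      Dense (Set.range fun n : ℕ => ((1 + A.comp i) ^ n : Y →L[𝕜] Y) y) ∧
      ∀ k, ∃ m > k, ‖f.comp ((1 + i.comp A) ^ m : Z →L[𝕜] Z)‖ < 1 := by
  obtain ⟨e, g, heg, hdense⟩ := exists_biorthogonal_int i hi
  have : SecondCountableTopology Y := UniformSpace.secondCountable_of_separable Y
  obtain ⟨D, hD⟩ : ∃ D, D = strictUpper e g := ⟨_, rfl⟩
  obtain ⟨D', hD'⟩ : ∃ D', D' = Submodule.span 𝕜 (Set.range g) := ⟨_, rfl⟩
  have : CompleteSpace D.topologicalClosure :=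
    D.isClosed_topologicalClosure.completeSpace_coe
  have : CompleteSpace D'.topologicalClosure :=
    D'.isClosed_topologicalClosure.completeSpace_coe
  let O : TopologicalSpace.countableBasis Y →
      Set (D.topologicalClosure × D'.topologicalClosure × Y) := fun V =>
    ⋃ n : ℕ, {p | ((1 + (p.1 : Z →L[𝕜] Y).comp i) ^ n : Y →L[𝕜] Y) p.2.2 ∈ (V : Set Y)}
  let G : ℕ → Set (D.topologicalClosure × D'.topologicalClosure × Y) := fun k => ⋃ m > k,
    {p | ‖(p.2.1 : Z →L[𝕜] 𝕜).comp ((1 + i.comp (p.1 : Z →L[𝕜] Y)) ^ m : Z →L[𝕜] Z)‖ < 1}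
  have hOo : ∀ V, IsOpen (O V) := fun V => isOpen_iUnion fun n =>
    (TopologicalSpace.isOpen_of_mem_countableBasis V.2).preimage (by fun_prop)
  have hGo : ∀ k, IsOpen (G k) := fun k => isOpen_biUnion fun m _ =>
    isOpen_lt (by fun_prop) continuous_const
  have hOd : ∀ V, Dense (O V) := by
    rintro ⟨V, hV⟩
    refine dense_of_approx hdense fun a ha f hf y hy ε hε => ?_
    obtain ⟨v, hvV, hv⟩ := hdense.inter_open_nonempty V
      (TopologicalSpace.isOpen_of_mem_countableBasis hV)
      (TopologicalSpace.nonempty_of_mem_countableBasis hV)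
    obtain ⟨B, hB, hev⟩ := exists_perturb_tendsto heg (hD ▸ ha) hy hv
    rw [← hD] at hB
    obtain ⟨δ, ⟨x, -, hx1, hx2⟩, hδ⟩ := exists_small_ne_zero B hε hev
    obtain ⟨n, hn1, hn2⟩ := ((Metric.tendsto_nhds.1 hx1 ε hε).and (hx2.eventually
      ((TopologicalSpace.isOpen_of_mem_countableBasis hV).mem_nhds hvV))).exists
    refine ⟨(⟨a + δ • B, D.le_topologicalClosure (D.add_mem ha (D.smul_mem _ hB))⟩,
      ⟨f, D'.le_topologicalClosure hf⟩, x n), Set.mem_iUnion.2 ⟨n, hn2⟩, ?_, ?_, ?_⟩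
    · simpa using hδ
    · simpa using hε
    · simpa [dist_eq_norm] using hn1
  have hGd : ∀ k, Dense (G k) := by
    intro k
    refine dense_of_approx hdense fun a ha f hf y hy ε hε => ?_
    obtain ⟨B, hB, hev⟩ := exists_perturb_tendsto_dual heg (hD ▸ ha) (hD' ▸ hf)
      (Submodule.zero_mem _)
    obtain ⟨δ, ⟨x, hx, hx1, hx2⟩, hδ⟩ := exists_small_ne_zero B hε hev
    rw [← hD] at hB
    rw [← hD'] at hx
    obtain ⟨n, ⟨hn1, hn2⟩, hn3⟩ := (((Metric.tendsto_nhds.1 hx1 ε hε).and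
      (Metric.tendsto_nhds.1 hx2 1 one_pos)).and (eventually_gt_atTop k)).exists
    refine ⟨(⟨a + δ • B, D.le_topologicalClosure (D.add_mem ha (D.smul_mem _ hB))⟩,
      ⟨x n, D'.le_topologicalClosure (hx n)⟩, y), Set.mem_iUnion₂.2 ⟨n, hn3, ?_⟩, ?_, ?_, ?_⟩
    · rw [dist_zero_right] at hn2
      exact hn2
    · simpa using hδ
    · simpa [dist_eq_norm] using hn1
    · simpa using hε
  have hcount : Countable (TopologicalSpace.countableBasis Y) :=
    (TopologicalSpace.countable_countableBasis Y).to_subtype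
  have : BaireSpace (D.topologicalClosure × D'.topologicalClosure × Y) :=
    baireSpace_prod
  have hres := dense_iInter_of_isOpen (f := fun j : TopologicalSpace.countableBasis Y ⊕ ℕ =>
    Sum.elim O G j) (by rintro (V | k); exacts [hOo V, hGo k])
    (by rintro (V | k); exacts [hOd V, hGd k])
  have hg0 : g 0 ≠ 0 := fun h => by simpa [h] using heg 0 0
  obtain ⟨⟨A, f, y⟩, hf, hmem⟩ := hres.inter_open_nonempty {p | p.2.1 ≠ 0}
    (isOpen_ne.preimage (by fun_prop : Continuous
      fun p : D.topologicalClosure × D'.topologicalClosure × Y => p.2.1))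
    ⟨(0, ⟨g 0, D'.le_topologicalClosure (hD' ▸ Submodule.subset_span ⟨0, rfl⟩)⟩, 0),
      fun h => hg0 (congrArg Subtype.val h)⟩
  rw [Set.mem_iInter] at hmem
  refine ⟨A, f, y, fun h => hf (Subtype.ext h), ?_, fun k => ?_⟩
  · rw [(TopologicalSpace.isBasis_countableBasis Y).dense_iff]
    intro V hV _
    obtain ⟨n, hn⟩ := Set.mem_iUnion.1 (hmem (Sum.inl ⟨V, hV⟩))
    exact ⟨_, hn, n, rfl⟩
  · obtain ⟨m, hm, h⟩ := Set.mem_iUnion₂.1 (hmem (Sum.inr k))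
    exact ⟨m, hm, h⟩

end Generic

section Factorization

variable {𝕜 X Y Z : Type*} [RCLike 𝕜] [AddCommGroup X] [Module 𝕜 X] [TopologicalSpace X]
  [IsTopologicalAddGroup X]
  [NormedAddCommGroup Y] [NormedSpace 𝕜 Y] [NormedAddCommGroup Z] [NormedSpace 𝕜 Z]

theorem one_add_pow_apply_comm (j : Y →L[𝕜] X) (B : X →L[𝕜] Y) (n : ℕ) (y : Y) :
    ((1 + j.comp B) ^ n : X →L[𝕜] X) (j y) = j (((1 + B.comp j) ^ n : Y →L[𝕜] Y) y) := by
  induction n with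
  | zero => rfl
  | succ n ih =>
    rw [pow_succ', mul_apply_eq_comp, ih, pow_succ', mul_apply_eq_comp]
    simp only [add_apply, one_apply_eq_self, ContinuousLinearMap.comp_apply, map_add]

theorem apply_one_add_pow_comm (π : X →L[𝕜] Z) (B : Z →L[𝕜] X) (n : ℕ) (x : X) :
    π (((1 + B.comp π) ^ n : X →L[𝕜] X) x) = ((1 + π.comp B) ^ n : Z →L[𝕜] Z) (π x) := by
  induction n with
  | zero => rfl
  | succ n ih =>
    rw [pow_succ', mul_apply_eq_comp, pow_succ', mul_apply_eq_comp, ← ih]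
    simp only [add_apply, one_apply_eq_self, ContinuousLinearMap.comp_apply, map_add]

/-- A functional whose composites with infinitely many powers of the operator induced on a normed
quotient are bounded prevents mixing. -/
theorem not_isMixing_of_norm_comp_lt_one {π : X →L[𝕜] Z} (hπ : Function.Surjective π)
    {T : X →L[𝕜] X} {S : Z →L[𝕜] Z} (hTS : ∀ n x, π ((T ^ n) x) = (S ^ n) (π x))
    {f : Z →L[𝕜] 𝕜} (hf : f ≠ 0) (h : ∀ k, ∃ m > k, ‖f.comp (S ^ m)‖ < 1) : ¬ IsMixing T := by
  intro hmix
  obtain ⟨z, hz⟩ : ∃ z, f z ≠ 0 := by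
    by_contra! hcon
    exact hf (ContinuousLinearMap.ext hcon)
  obtain ⟨x, hx⟩ := hπ ((2 * (f z)⁻¹) • z)
  obtain ⟨N, hN⟩ := hmix {x | ‖π x‖ < 1} {x | 1 < ‖f (π x)‖}
    (isOpen_lt (by fun_prop) continuous_const) ⟨0, by simp⟩
    (isOpen_lt continuous_const (by fun_prop)) ⟨x, by simp [hx, hz]⟩
  obtain ⟨m, hm, hlt⟩ := h N
  obtain ⟨_, ⟨w, hw, rfl⟩, hV⟩ := hN m hm
  have hw : ‖π w‖ < 1 := hw
  have hV : 1 < ‖f (π ((T ^ m) w))‖ := hV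
  rw [hTS] at hV
  have h1 := (f.comp (S ^ m)).le_opNorm (π w)
  rw [ContinuousLinearMap.comp_apply] at h1
  nlinarith [norm_nonneg (π w), norm_nonneg (f.comp (S ^ m))]

/-- A space receiving an operator with dense range from a separable Banach space and having an
infinite-dimensional normed quotient carries a hypercyclic non-mixing operator. -/
theorem exists_isHypercyclic_not_isMixing [CompleteSpace Y] [TopologicalSpace.SeparableSpace Y]
    (j : Y →L[𝕜] X) (hj : DenseRange j) (π : X →L[𝕜] Z) (hπ : Function.Surjective π)
    (hZ : ¬ FiniteDimensional 𝕜 Z) :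
    ∃ T : X →L[𝕜] X, IsHypercyclic T ∧ ¬ IsMixing T := by
  have hi : ¬ FiniteDimensional 𝕜 (LinearMap.range ((π.comp j : Y →L[𝕜] Z) : Y →ₗ[𝕜] Z)) := by
    intro hfin
    refine hZ ?_
    have hd : DenseRange (π.comp j) := hπ.denseRange.comp hj π.continuous
    have hclosed := Submodule.closed_of_finiteDimensional
      (LinearMap.range ((π.comp j : Y →L[𝕜] Z) : Y →ₗ[𝕜] Z))
    have htop : LinearMap.range ((π.comp j : Y →L[𝕜] Z) : Y →ₗ[𝕜] Z) = ⊤ := by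
      rw [Submodule.eq_top_iff']
      intro z
      have : z ∈ closure (Set.range (π.comp j)) := hd z
      exact hclosed.closure_subset_iff.2 (by rintro _ ⟨y, rfl⟩; exact ⟨y, rfl⟩) this
    rw [htop] at hfin
    exact Module.Finite.of_surjective (⊤ : Submodule 𝕜 Z).subtype (fun z => ⟨⟨z, trivial⟩, rfl⟩)
  obtain ⟨A, f, y, hf, hy, hm⟩ := exists_hypercyclic_one_add_comp (π.comp j) hi
  refine ⟨1 + j.comp (A.comp π), ⟨j y, ?_⟩, ?_⟩
  · simp only [one_add_pow_apply_comm]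
    have := hj.dense_image j.continuous hy
    rwa [← Set.range_comp] at this
  · refine not_isMixing_of_norm_comp_lt_one hπ (S := 1 + (π.comp j).comp A) ?_ hf hm
    exact fun n x => apply_one_add_pow_comm π (j.comp A) n x

end Factorization

section ClassM

universe u

/-- Every seminorm is the pullback of a norm along a surjection. -/
theorem exists_normed_quotient {𝕜 : Type*} {X : Type u} [RCLike 𝕜] [AddCommGroup X] [Module 𝕜 X]
    (p : Seminorm 𝕜 X) :
    ∃ (Z : Type u) (_ : NormedAddCommGroup Z) (_ : NormedSpace 𝕜 Z) (π : X →ₗ[𝕜] Z),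
      Function.Surjective π ∧ ∀ x, ‖π x‖ = p x := by
  let _ : SeminormedAddCommGroup X := p.toAddGroupSeminorm.toSeminormedAddCommGroup
  let _ : NormedSpace 𝕜 X := ⟨fun c x => (map_smul_eq_mul p c x).le⟩
  exact ⟨SeparationQuotient X, inferInstance, inferInstance,
    (SeparationQuotient.mkCLM 𝕜 X : X →ₗ[𝕜] SeparationQuotient X),
    SeparationQuotient.surjective_mk, fun x => SeparationQuotient.norm_mk x⟩

variable {𝕜 : Type*} {X : Type u} [RCLike 𝕜] [AddCommGroup X] [Module 𝕜 X] [Module ℝ X]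
  [IsScalarTower ℝ 𝕜 X] [TopologicalSpace X] [IsTopologicalAddGroup X] [ContinuousSMul 𝕜 X]
  [LocallyConvexSpace ℝ X]

open scoped ComplexOrder in
theorem exists_continuous_seminorm_ball_subset {U : Set X} (hU : U ∈ 𝓝 (0 : X)) :
    ∃ p : Seminorm 𝕜 X, Continuous p ∧ p.ball 0 1 ⊆ U := by
  have : ContinuousSMul ℝ X := IsScalarTower.continuousSMul 𝕜
  have : LocallyConvexSpace 𝕜 X := by
    rw [locallyConvexSpace_iff_exists_convex_subset_zero]
    intro U hU
    obtain ⟨S, hS, hconv, hSU⟩ := (locallyConvexSpace_iff_exists_convex_subset_zero ℝ X).1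
      inferInstance U hU
    exact ⟨S, hS, convex_of_nonneg_surjective_algebraMap _
      (fun _ => RCLike.nonneg_iff_exists_ofReal.mp) hconv, hSU⟩
  obtain ⟨s, hs, hsU⟩ := (nhds_hasBasis_absConvex_open 𝕜 X).mem_iff.1 hU
  refine ⟨gaugeSeminormFamily 𝕜 X ⟨s, hs⟩, with_gaugeSeminormFamily.continuous_seminorm _, ?_⟩
  exact (gaugeSeminormFamily_ball (⟨s, hs⟩ : AbsConvexOpenSets 𝕜 X)).le.trans hsU

theorem continuous_of_continuous_repr {𝕜 W Z ι : Type*} [RCLike 𝕜] [TopologicalSpace W]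
    [NormedAddCommGroup Z] [NormedSpace 𝕜 Z] [Fintype ι] (b : Module.Basis ι 𝕜 Z) {φ : W → Z}
    (h : ∀ k, Continuous fun w => b.repr (φ w) k) : Continuous φ := by
  have : φ = fun w => ∑ k, b.repr (φ w) k • b k := funext fun w => (b.sum_repr (φ w)).symm
  rw [this]
  exact continuous_finsetSum _ fun k _ => (h k).smul continuous_const

/-- A locally convex topology all of whose normed quotients are finite-dimensional is weak. -/
theorem carriesWeakTopology_of_finiteDimensional [T2Space X]
    (h : ∀ (Z : Type u) [NormedAddCommGroup Z] [NormedSpace 𝕜 Z] (π : X →L[𝕜] Z),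
      Function.Surjective π → FiniteDimensional 𝕜 Z) : CarriesWeakTopology 𝕜 X := by
  refine ⟨LinearMap.range (ContinuousLinearMap.coeLM 𝕜 : (X →L[𝕜] 𝕜) →ₗ[𝕜] X →ₗ[𝕜] 𝕜), ?_, ?_⟩
  · intro x hx
    obtain ⟨f, hf⟩ := RCLike.geometric_hahn_banach_point_point (𝕜 := 𝕜) hx
    refine ⟨f, ⟨f, rfl⟩, fun h0 => ?_⟩
    have h0 : f x = 0 := h0
    simp [h0] at hf
  refine IsTopologicalAddGroup.ext inferInstance ?_ (le_antisymm ?_ ?_)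
  · exact topologicalAddGroup_iInf fun f => topologicalAddGroup_induced f.1
  · refine nhds_mono (le_iInf ?_)
    rintro ⟨_, f, rfl⟩
    exact continuous_iff_le_induced.1 f.continuous
  · intro U hU
    obtain ⟨p, hp, hpU⟩ := exists_continuous_seminorm_ball_subset (𝕜 := 𝕜) hU
    obtain ⟨Z, _, _, π, hπ, hπp⟩ := exists_normed_quotient p
    have hcont : Continuous π := by
      refine continuous_of_continuousAt_zero π ?_
      rw [ContinuousAt, map_zero, tendsto_zero_iff_norm_tendsto_zero]
      simp only [hπp]
      simpa using hp.tendsto 0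
    have := h Z ⟨π, hcont⟩ hπ
    let b := Module.finBasis 𝕜 Z
    have hweak := @continuous_of_continuous_repr 𝕜 X Z _ _
      (⨅ f : LinearMap.range (ContinuousLinearMap.coeLM 𝕜 : (X →L[𝕜] 𝕜) →ₗ[𝕜] X →ₗ[𝕜] 𝕜),
        TopologicalSpace.induced (fun x : X => (f : Module.Dual 𝕜 X) x) inferInstance)
      _ _ _ b π fun k => continuous_iff_le_induced.2 <| iInf_le_of_le
        ⟨_, (LinearMap.toContinuousLinearMap (b.coord k)).comp ⟨π, hcont⟩, rfl⟩ le_rfl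
    have hball : Metric.ball (0 : Z) 1 ∈ 𝓝 (π 0) := by
      rw [map_zero]
      exact Metric.ball_mem_nhds _ one_pos
    refine mem_of_superset ((@Continuous.tendsto _ _ (_) _ _ hweak 0) hball) fun x hx => hpU ?_
    rw [Seminorm.mem_ball_zero, ← hπp]
    simpa using hx

/-- An `ℓ₁`-sequence is the image of the unit vectors under an operator on `ℓ₁`. -/
theorem IsEllOneSequence.exists_continuousLinearMap [T2Space X] {x : ℕ → X}
    (hx : IsEllOneSequence 𝕜 x) :
    ∃ j : lp (fun _ : ℕ => 𝕜) 1 →L[𝕜] X, ∀ n, j (lp.single 1 n 1) = x n := by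
  have hsum : ∀ a : lp (fun _ : ℕ => 𝕜) 1, HasSum (fun n => ‖a n‖) ‖a‖ := fun a => by
    simpa using lp.hasSum_norm (p := 1) (by simp) a
  choose s hs using fun a : lp (fun _ : ℕ => 𝕜) 1 => hx.2 (fun n => a n) (hsum a).summable
  let j : lp (fun _ : ℕ => 𝕜) 1 →ₗ[𝕜] X :=
    { toFun := s
      map_add' := fun a b => tendsto_nhds_unique (hs (a + b)) <| by
        simpa [add_smul, Finset.sum_add_distrib] using (hs a).add (hs b)
      map_smul' := fun c a => tendsto_nhds_unique (hs (c • a)) <| by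
        simpa [mul_smul, Finset.smul_sum] using (hs a).const_smul c }
  have hj : Continuous j := by
    refine continuous_of_continuousAt_zero j ?_
    rw [ContinuousAt, map_zero]
    intro U hU
    obtain ⟨p, hp, hpU⟩ := exists_continuous_seminorm_ball_subset (𝕜 := 𝕜) hU
    have hlim : Tendsto (fun n => p (x n)) atTop (𝓝 0) := by
      simpa [Function.comp_def] using (hp.tendsto 0).comp hx.1
    obtain ⟨C, hC⟩ := hlim.bddAbove_range
    have hC : ∀ n, p (x n) ≤ C := fun n => hC ⟨n, rfl⟩
    have hC0 : 0 ≤ C := (apply_nonneg p _).trans (hC 0)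
    have hbound : ∀ a, p (j a) ≤ C * ‖a‖ := by
      intro a
      refine le_of_tendsto ((hp.tendsto _).comp (hs a)) (Eventually.of_forall fun N => ?_)
      calc p (∑ n ∈ Finset.range N, a n • x n) ≤ ∑ n ∈ Finset.range N, p (a n • x n) :=
            Finset.le_sum_of_subadditive p (map_zero p).le (map_add_le_add p) _ _
        _ ≤ ∑ n ∈ Finset.range N, C * ‖a n‖ := by
            refine Finset.sum_le_sum fun n _ => ?_
            rw [map_smul_eq_mul, mul_comm]
            exact mul_le_mul_of_nonneg_right (hC n) (norm_nonneg _)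
        _ ≤ C * ‖a‖ := by
            rw [← Finset.mul_sum]
            exact mul_le_mul_of_nonneg_left
              (sum_le_hasSum _ (fun n _ => norm_nonneg _) (hsum a)) hC0
    change ∀ᶠ a in 𝓝 0, j a ∈ U
    filter_upwards [Metric.ball_mem_nhds (0 : lp (fun _ : ℕ => 𝕜) 1)
      (show 0 < 1 / (C + 1) by positivity)] with a ha
    refine hpU ?_
    rw [Seminorm.mem_ball_zero]
    rw [mem_ball_zero_iff, lt_div_iff₀ (by positivity)] at ha
    nlinarith [hbound a, norm_nonneg a]
  refine ⟨⟨j, hj⟩, fun n => tendsto_nhds_unique (hs _) ?_⟩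
  refine tendsto_const_nhds.congr' ?_
  filter_upwards [eventually_gt_atTop n] with N hN
  rw [Finset.sum_eq_single n]
  · simp
  · intro k _ hk
    rw [lp.single_apply_ne _ _ _ hk, zero_smul]
  · intro h
    exact absurd (Finset.mem_range.2 hN) h

theorem separableSpace_lp_one : TopologicalSpace.SeparableSpace (lp (fun _ : ℕ => 𝕜) 1) := by
  have hsep : TopologicalSpace.IsSeparable (Submodule.span 𝕜
      (Set.range fun n : ℕ => (lp.single 1 n 1 : lp (fun _ : ℕ => 𝕜) 1)) :
        Set (lp (fun _ : ℕ => 𝕜) 1)) :=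
    (Set.countable_range _).isSeparable.span
  rw [← TopologicalSpace.isSeparable_univ_iff]
  refine hsep.closure.mono fun a _ => ?_
  refine mem_closure_of_tendsto (lp.hasSum_single (p := 1) (by simp) a)
    (Eventually.of_forall fun F => Submodule.sum_mem _ fun n _ => ?_)
  have : lp.single (E := fun _ : ℕ => 𝕜) 1 n (a n) = a n • lp.single 1 n 1 := by
    rw [← lp.single_smul, smul_eq_mul, mul_one]
  rw [this]
  exact Submodule.smul_mem _ _ (Submodule.subset_span ⟨n, rfl⟩)

end ClassM

theorem theorem1p7 {𝕜 : Type*} [RCLike 𝕜] :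
    (∀ (X : Type*) [AddCommGroup X] [Module 𝕜 X] [Module ℝ X] [IsScalarTower ℝ 𝕜 X]
      [TopologicalSpace X] [IsTopologicalAddGroup X] [ContinuousSMul 𝕜 X]
      [LocallyConvexSpace ℝ X] [T2Space X],
      MemClassM 𝕜 X → ∃ T : X →L[𝕜] X, IsHypercyclic T ∧ ¬ IsMixing T) ∧
    (∀ (X : Type*) [NormedAddCommGroup X] [NormedSpace 𝕜 X] [CompleteSpace X]
      [TopologicalSpace.SeparableSpace X],
      ¬ FiniteDimensional 𝕜 X → ∃ T : X →L[𝕜] X, IsHypercyclic T ∧ ¬ IsMixing T) := by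
  refine ⟨fun X _ _ _ _ _ _ _ _ _ hX => ?_, fun X _ _ _ _ hX => ?_⟩
  · obtain ⟨x, hx, hdense⟩ := hX.exists_seq
    obtain ⟨j, hj⟩ := hx.exists_continuousLinearMap
    have hjd : DenseRange j := by
      refine hdense.mono ?_
      change _ ≤ LinearMap.range (j : lp (fun _ : ℕ => 𝕜) 1 →ₗ[𝕜] X)
      rw [Submodule.span_le]
      rintro _ ⟨n, rfl⟩
      exact ⟨_, hj n⟩
    by_contra hcon
    refine hX.not_weak (carriesWeakTopology_of_finiteDimensional fun Z _ _ π hπ => ?_)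
    by_contra hZ
    have := separableSpace_lp_one (𝕜 := 𝕜)
    exact hcon (exists_isHypercyclic_not_isMixing j hjd π hπ hZ)
  · exact exists_isHypercyclic_not_isMixing (ContinuousLinearMap.id 𝕜 X) denseRange_id
      (ContinuousLinearMap.id 𝕜 X) Function.surjective_id hX
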